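/- For integers $n\ge 1$ and $h\ge 2$ let $ZT(n,h)$ be the zig-zag tubulene with $n$ layers of $h$ hexagons each: its vertices are $v^k_{i,j}$ with $0\le i\le n$, $k\in\{0,1\}$, $j\in\mathbb{Z}/h\mathbb{Z}$, and its edges are $v^0_{i,j}v^1_{i,j}$ and $v^0_{i,j}v^1_{i,j+1}$ for $0\le i\le n$, and $v^1_{i,j}v^0_{i+1,j}$ for $0\le i<n$ (for all $j$). For a finite connected graph $G$ with distance $d_G$ and automorphism group $\mathrm{Aut}(G)$, the Graovac–Pisanski index is $$\widehat W(G)=\frac{|V(G)|}{2|\mathrm{Aut}(G)|}\sum_{u\in V(G)}\ \sum_{\alpha\in \mathrm{Aut}(G)} d_G(u,\alpha(u)).$$ Then $\widehat W=\widehat W(ZT(n,h))$ is given as follows. 1. $h$ odd and $n$ odd: - if $n<h-2$: $\widehat W=\frac{h}{6}(n+1)^2(6h^2+3hn+3h+n^2+2n-3)$; - if $n=h-2$ and $n\ge 3$: $\widehat W=\frac{h}{6}(n+1)(6h^2n+3h^2+3hn^2+12hn+9h+n^3-7n-3)$; - if $n\ge h$ and $h\ge 5$: $\widehat W=\frac{h}{6}(n+1)(h^3+3h^2n+3h^2+6hn^2+12hn+5h-3n-3)$.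 2. $h$ even and $n$ odd: - if $n<h-2$: $\widehat W=\frac{h}{6}(n+1)^2(6h^2+3hn+3h+n^2+2n+3)$; - if $n=h-1$ and $n\ge 3$: $\widehat W=\frac{h}{6}(n+1)(6h^2n+3h^2+3hn^2+12hn+9h+n^3-n)$; - if $n\ge h$ and $h\ge 4$: $\widehat W=\frac{h^2}{6}(n+1)(h^2+3hn+3h+6n^2+12n+8)$. 3. $h$ odd and $n$ even: - if $n<h-2$: $\widehat W=\frac{h}{6}(n+1)(6h^2n+6h^2+3hn^2+6hn+n^3+3n^2+2n)$; - if $n=h-1$ and $n\ge 4$: $\widehat W=\frac{h}{6}(n+1)(6h^2n+3h^2+3hn^2+12hn+6h+n^3-4n-3)$; - if $n\ge h$ and $h\ge 5$: $\widehat W=\frac{h}{6}(n+1)(h^3+3h^2n+3h^2+6hn^2+12hn+5h-3n-3)$. 4. $h$ even and $n$ even: - if $n<h-2$: $\widehat W=\frac{h}{6}(n+1)(6h^2n+6h^2+3hn^2+6hn+n^3+3n^2+2n)$; - if $n=h-2$ and $n\ge 4$: $\widehat W=\frac{h}{6}(n+1)(6h^2n+3h^2+3hn^2+12hn+6h+n^3-4n)$;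 - if $n\ge h$ and $h\ge 6$: $\widehat W=\frac{h^2}{6}(n+1)(h^2+3hn+3h+6n^2+12n+2)$. -/

import Mathlib

/-- The Graovac–Pisanski index of a finite graph `G`:
`|V(G)| / (2 |Aut(G)|) * ∑ u ∈ V(G), ∑ α ∈ Aut(G), d_G(u, α(u))`,
where `Aut(G)` is the group `G ≃g G` of all graph automorphisms of `G`
(a finite type, so the `finsum` below is an ordinary finite sum). -/
noncomputable def graovacPisanskiIndex {V : Type*} [Fintype V] (G : SimpleGraph V) : ℚ :=
  (Fintype.card V : ℚ) / (2 * (Nat.card (G ≃g G) : ℚ)) *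
    ∑ u : V, ∑ᶠ α : G ≃g G, (G.dist u (α u) : ℚ)

/-- The vertices of the zig-zag tubulene `ZT(n,h)`: the triple `(i, k, j)` is the vertex
`v^k_{i,j}`, the `j`-th vertex of type `k` in layer `i`; there are `n + 1` layers, two types,
and `h` vertices of each type in each layer, indexed cyclically. -/
abbrev ZTVertex (n h : ℕ) : Type := Fin (n + 1) × Fin 2 × ZMod h

/-- The edges of `ZT(n,h)`, each listed from its endpoint `x` of type `0` to its endpoint `y` of
type `1`. In every layer the `2h` vertices form the zig-zag cycle
`v^0_{i,0}, v^1_{i,1}, v^0_{i,1}, v^1_{i,2}, …`, that is, `v^0_{i,j}` is joined to `v^1_{i,j}` and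
to `v^1_{i,j+1}`. Between consecutive layers `v^1_{i,j}` is joined to `v^0_{i+1,j}`.
This is the hexagonal lattice (with vertices of type `k` in the lattice cells `(i, j) ∈ ℤ × ℤ`)
restricted to `0 ≤ i ≤ n` and rolled up along `h` times the basic lattice vector `(0, 1)`.
The hexagons are `v^1_{i,j}, v^0_{i,j}, v^1_{i,j+1}, v^0_{i+1,j+1}, v^1_{i+1,j+1}, v^0_{i+1,j}`
for `0 ≤ i < n` and `j ∈ ℤ/hℤ`: there are `n` layers of `h` hexagons each. -/
def ZTEdge (n h : ℕ) (x y : ZTVertex n h) : Prop :=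
  x.2.1 = 0 ∧ y.2.1 = 1 ∧
    ((x.1 = y.1 ∧ (y.2.2 = x.2.2 ∨ y.2.2 = x.2.2 + 1)) ∨
      (x.1.val = y.1.val + 1 ∧ x.2.2 = y.2.2))

/-- The zig-zag tubulene `ZT(n,h)`. -/
def ZT (n h : ℕ) : SimpleGraph (ZTVertex n h) where
  Adj x y := ZTEdge n h x y ∨ ZTEdge n h y x
  symm := ⟨fun _ _ hxy => hxy.symm⟩
  loopless := ⟨fun x hx => by
    rcases hx with hx | hx <;> exact absurd (hx.1.symm.trans hx.2.1) (by decide)⟩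

/-!
The automorphism group enters the index only through its orbits. Write `m = n + 1` and call the
vertices `(i, k, j)` with fixed `i` and `k` a row; the rows are numbered by their height
`2 * i + k`. The vertices of degree two are those of the two extreme rows. The vertices of one
extreme row are linked by steps of distance two, whereas the two extreme rows are at distance at
least three, so an automorphism preserves or exchanges them. As the height is the distance to the
row of height `0`, an automorphism preserves all heights or reverses them (`ZT.height_map`).
Conversely the rotations and the reflection of the tube act transitively on the union of a row and
its mirror image. Hence averaging over these symmetries turns the index into a sum of distances
from each vertex to its own row and to the mirror row
(`ZT.graovacPisanskiIndex_eq_sum_orbitSum`).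

For the distances, the tube is unrolled to the hexagonal lattice, embedded in `ℤ³` so that an edge
changes one coordinate by `1`; the distance there is the `ℓ¹`-distance `hexLength`, and the
distance in the tube is its minimum over all lifts. For rows whose layers differ by `a` and whose
types differ by `κ`, put `c = κ + a`. Then `hexLength a κ b = |a| + max |c| |2 * b - c|`, and the
minimum is attained where `-h < 2 * b - c ≤ h`. Summing over a row gives
`h * |a| + maxSum h c` (`ZT.sum_dist_row`), where `maxSum h c` is `⌊(h² + c²) / 2⌋` if `|c| ≤ h`
and `h * |c|` otherwise. Within a row `a = c = 0`, and between a row and its mirror image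
`c = ±(m - 2 * i)` with `0 ≤ i < m`. So the quadratic branch of `maxSum` alone is needed when
`m ≤ h + 1`; beyond that, passing from `m` to `m + 2` adds two terms of the linear branch. The
parities of `h` and `n` enter through the floors.
-/

/-! ### Distances -/

/-- The distance in the (unrolled, unbounded) hexagonal lattice between two vertices whose layer,
type and position differ by `a`, `κ` and `b`. In the coordinates `(-i, k + i - j, j)` an edge
changes exactly one coordinate, by `1`; this is the `ℓ¹`-distance for them. -/
def hexLength (a κ b : ℤ) : ℤ := |a| + |b| + |κ + a - b|

namespace ZT

variable {n h : ℕ}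

/-- Walks lift to the unrolled lattice, where each step changes `hexLength` by at most one. -/
theorem exists_lift_hexLength_le {u v : ZTVertex n h} (p : (ZT n h).Walk u v) :
    ∀ j : ℤ, (j : ZMod h) = u.2.2 → ∃ b : ℤ, ((j + b : ℤ) : ZMod h) = v.2.2 ∧
      hexLength ((v.1 : ℤ) - (u.1 : ℤ)) ((v.2.1 : ℤ) - (u.2.1 : ℤ)) b ≤ p.length := by
  induction p with
  | nil => intro j hj; exact ⟨0, by simpa using hj, by simp [hexLength]⟩
  | @cons u w v huw p ih =>
    obtain ⟨i, k, x⟩ := u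
    obtain ⟨i', k', x'⟩ := w
    obtain ⟨i'', k'', x''⟩ := v
    intro j hj
    have step : ∃ c : ℤ, ((j + c : ℤ) : ZMod h) = x' ∧
        hexLength ((i' : ℤ) - (i : ℤ)) ((k' : ℤ) - (k : ℤ)) c ≤ 1 := by
      simp only at hj
      rcases huw with ⟨h1, h2, ⟨h3, h4 | h4⟩ | ⟨h3, h4⟩⟩ | ⟨h1, h2, ⟨h3, h4 | h4⟩ | ⟨h3, h4⟩⟩ <;>
        simp only at h1 h2 h3 h4 <;> subst h1 h2
      · exact ⟨0, by simp [hj, h4], by simp [hexLength, h3]⟩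
      · exact ⟨1, by simp [hj, h4], by simp [hexLength, h3]⟩
      · exact ⟨0, by simp [hj, h4], by simp [hexLength, h3]⟩
      · exact ⟨0, by simp [hj, h4], by simp [hexLength, h3]⟩
      · exact ⟨-1, by simp [hj, h4], by simp [hexLength, h3]⟩
      · exact ⟨0, by simp [hj, h4], by simp [hexLength, h3]⟩
    obtain ⟨c, hc, hc'⟩ := step
    obtain ⟨b, hb, hb'⟩ := ih (j + c) hc
    refine ⟨c + b, by rw [← hb]; congr 1; ring, ?_⟩
    rw [SimpleGraph.Walk.length_cons]
    push_cast
    simp only [hexLength] at *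
    grind

/-- Every vertex of the unrolled lattice is reached by a walk of length `hexLength`: some step
towards it decreases `hexLength`, and steps towards it stay between the layers `0` and `n`. -/
theorem exists_walk_length_eq (N : ℕ) : ∀ (i i' : Fin (n + 1)) (k k' : Fin 2) (j b : ℤ),
    hexLength ((i' : ℤ) - (i : ℤ)) ((k' : ℤ) - (k : ℤ)) b = N →
    ∃ p : (ZT n h).Walk (i, k, (j : ZMod h)) (i', k', ((j + b : ℤ) : ZMod h)), p.length = N := by
  induction N with
  | zero =>
    intro i i' k k' j b hN
    simp only [hexLength] at hN
    have h₁ := abs_nonneg ((i' : ℤ) - (i : ℤ))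
    have h₂ := abs_nonneg b
    have h₃ := abs_nonneg ((k' : ℤ) - (k : ℤ) + ((i' : ℤ) - (i : ℤ)) - b)
    have h₁' := abs_eq_zero.1 (show |(i' : ℤ) - (i : ℤ)| = 0 by omega)
    obtain rfl := abs_eq_zero.1 (show |b| = 0 by omega)
    have h₃' := abs_eq_zero.1
      (show |(k' : ℤ) - (k : ℤ) + ((i' : ℤ) - (i : ℤ)) - 0| = 0 by omega)
    obtain rfl : i = i' := by omega
    obtain rfl : k = k' := by omega
    rw [add_zero]
    exact ⟨.nil, rfl⟩
  | succ N ih =>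
    intro i i' k k' j b hN
    have step (i₁ : Fin (n + 1)) (k₁ : Fin 2) (c : ℤ)
        (hadj : (ZT n h).Adj (i, k, (j : ZMod h)) (i₁, k₁, ((j + c : ℤ) : ZMod h)))
        (hlen : hexLength ((i' : ℤ) - (i₁ : ℤ)) ((k' : ℤ) - (k₁ : ℤ)) (b - c) = N) :
        ∃ p : (ZT n h).Walk (i, k, (j : ZMod h)) (i', k', ((j + b : ℤ) : ZMod h)),
          p.length = N + 1 := by
      have h₁ := ih i₁ i' k₁ k' (j + c) (b - c) hlen
      rw [show j + c + (b - c) = j + b by ring] at h₁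
      obtain ⟨p, hp⟩ := h₁
      exact ⟨.cons hadj p, by rw [SimpleGraph.Walk.length_cons, hp]⟩
    simp only [hexLength] at hN
    have hk' := k'.isLt
    push_cast at hN
    rcases (by omega : k = 0 ∨ k = 1) with rfl | rfl
    · simp only [Fin.val_zero, Nat.cast_zero] at hN
      by_cases hb : 0 < b
      · refine step i 1 1 (Or.inl ⟨rfl, rfl, Or.inl ⟨rfl, Or.inr (by simp)⟩⟩) ?_
        simp only [hexLength, Fin.val_one]; grind
      by_cases hy : 0 < (k' : ℤ) + (i' - i) - b
      · refine step i 1 0 (Or.inl ⟨rfl, rfl, Or.inl ⟨rfl, Or.inl (by simp)⟩⟩) ?_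
        simp only [hexLength, Fin.val_one]; grind
      have hi : (i' : ℕ) < i := by grind
      refine step ⟨i - 1, by omega⟩ 1 0
        (Or.inl ⟨rfl, rfl, Or.inr ⟨?_, by simp⟩⟩) ?_
      · simp only; omega
      · simp only [hexLength, Fin.val_one]; grind
    · simp only [Fin.val_one, Nat.cast_one] at hN
      by_cases hb : b < 0
      · refine step i 0 (-1) (Or.inr ⟨rfl, rfl, Or.inl ⟨rfl, Or.inr (by simp)⟩⟩) ?_
        simp only [hexLength, Fin.val_zero]; grind
      by_cases hy : (k' : ℤ) - 1 + (i' - i) - b < 0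
      · refine step i 0 0 (Or.inr ⟨rfl, rfl, Or.inl ⟨rfl, Or.inl (by simp)⟩⟩) ?_
        simp only [hexLength, Fin.val_zero]; grind
      have hi : (i : ℕ) < i' := by grind
      refine step ⟨i + 1, by omega⟩ 0 0
        (Or.inr ⟨rfl, rfl, Or.inr ⟨rfl, by simp⟩⟩) ?_
      simp only [hexLength, Fin.val_zero]; grind

theorem hexLength_eq_add_max (a κ b : ℤ) :
    hexLength a κ b = |a| + max |κ + a| |2 * b - (κ + a)| := by
  simp only [hexLength]
  grind

theorem dist_le_hexLength (i i' : Fin (n + 1)) (k k' : Fin 2) (j b : ℤ) :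
    ((ZT n h).dist (i, k, (j : ZMod h)) (i', k', ((j + b : ℤ) : ZMod h)) : ℤ) ≤
      hexLength ((i' : ℤ) - (i : ℤ)) ((k' : ℤ) - (k : ℤ)) b := by
  have hpos : 0 ≤ hexLength ((i' : ℤ) - (i : ℤ)) ((k' : ℤ) - (k : ℤ)) b := by
    simp only [hexLength]; positivity
  obtain ⟨p, hp⟩ := exists_walk_length_eq (h := h) _ i i' k k' j b (Int.toNat_of_nonneg hpos).symm
  have := SimpleGraph.dist_le p
  omega

theorem exists_hexLength_le_dist (i i' : Fin (n + 1)) (k k' : Fin 2) (j b : ℤ) :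
    ∃ b' : ℤ, ((j + b' : ℤ) : ZMod h) = ((j + b : ℤ) : ZMod h) ∧
      hexLength ((i' : ℤ) - (i : ℤ)) ((k' : ℤ) - (k : ℤ)) b' ≤
        (ZT n h).dist (i, k, (j : ZMod h)) (i', k', ((j + b : ℤ) : ZMod h)) := by
  have hpos : 0 ≤ hexLength ((i' : ℤ) - (i : ℤ)) ((k' : ℤ) - (k : ℤ)) b := by
    simp only [hexLength]; positivity
  obtain ⟨p, -⟩ := exists_walk_length_eq (h := h) _ i i' k k' j b (Int.toNat_of_nonneg hpos).symm
  obtain ⟨q, hq⟩ := p.reachable.exists_walk_length_eq_dist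
  rw [← hq]
  exact exists_lift_hexLength_le q j rfl

/-- The minimum over all lifts is attained by the position `b` with the least `|2 * b - c|`. -/
theorem dist_eq (i i' : Fin (n + 1)) (k k' : Fin 2) (j b a c : ℤ) (ha : a = (i' : ℤ) - (i : ℤ))
    (hc : c = (k' : ℤ) - (k : ℤ) + a) (hb₁ : -h ≤ 2 * b - c) (hb₂ : 2 * b - c ≤ h) :
    ((ZT n h).dist (i, k, (j : ZMod h)) (i', k', ((j + b : ℤ) : ZMod h)) : ℤ) =
      |a| + max |c| |2 * b - c| := by
  apply le_antisymm
  · have := dist_le_hexLength (h := h) i i' k k' j b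
    rwa [hexLength_eq_add_max, ← ha, ← hc] at this
  · obtain ⟨b', hb', hle⟩ := exists_hexLength_le_dist (h := h) i i' k k' j b
    rw [hexLength_eq_add_max, ← ha, ← hc] at hle
    refine le_trans ?_ hle
    obtain ⟨q, hq⟩ := (ZMod.intCast_eq_intCast_iff_dvd_sub _ _ _).1 hb'
    -- all other lifts of the position differ from `b` by a multiple of `h`
    obtain rfl : b' = b - h * q := by linarith
    have hge : |2 * b - c| ≤ |2 * (b - h * q) - c| := by
      rcases lt_trichotomy q 0 with hq0 | rfl | hq0
      · have : (h : ℤ) * q ≤ -h := by nlinarith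
        grind
      · simp
      · have : (h : ℤ) ≤ h * q := by nlinarith
        grind
    gcongr

end ZT

/-! ### Sums of distances to a row -/

theorem ZMod.sum_eq_sum_range_add {M : Type*} [AddCommMonoid M] (h : ℕ) [NeZero h] (e : ℤ)
    (F : ZMod h → M) : ∑ s, F s = ∑ r ∈ Finset.range h, F ((e + r : ℤ) : ZMod h) := by
  rw [← Equiv.sum_comp (Equiv.addLeft (e : ZMod h))]
  refine Finset.sum_nbij' ZMod.val (fun r ↦ (r : ZMod h)) ?_ ?_ ?_ ?_ ?_
  · intro s _; exact Finset.mem_range.2 s.val_lt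
  · simp
  · simp
  · intro r hr; exact ZMod.val_cast_of_lt (Finset.mem_range.1 hr)
  · simp

/-- Peeling off both ends of the arithmetic progression `m + 2, m, …, -m`. -/
theorem Finset.sum_range_add_two_sub_two_mul {M : Type*} [AddCommMonoid M] (f : ℤ → M) (m : ℕ) :
    ∑ i ∈ Finset.range (m + 2), f ((m + 2 : ℕ) - 2 * i) =
      f (m + 2) + ∑ i ∈ Finset.range m, f (m - 2 * i) + f (-m) := by
  rw [Finset.sum_range_succ, Finset.sum_range_succ', add_comm (Finset.sum _ _)]
  refine congrArg₂ _ (congrArg₂ _ (congrArg f (by push_cast; ring)) ?_)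
    (congrArg f (by push_cast; ring))
  exact Finset.sum_congr rfl fun i _ ↦ congrArg f (by push_cast; ring)

/-- The sum of `max |c| |t|` over the `h` integers `t ≡ c (mod 2)` with `-h < t ≤ h`, in closed
form; see `sum_max_abs_eq_maxSum`. -/
def maxSum (h : ℕ) (c : ℤ) : ℤ := if |c| ≤ h then (h ^ 2 + c ^ 2) / 2 else h * |c|

theorem maxSum_neg (h : ℕ) (c : ℤ) : maxSum h (-c) = maxSum h c := by
  simp [maxSum]

/-- The quadratic branch of `maxSum` remains valid one step beyond `|c| = h`. -/
theorem maxSum_of_le {h : ℕ} {c : ℤ} (hc : |c| ≤ h + 1) : maxSum h c = (h ^ 2 + c ^ 2) / 2 := by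
  unfold maxSum
  split_ifs with h₁
  · rfl
  · rw [← sq_abs c, show |c| = h + 1 by omega]
    have : (h : ℤ) ^ 2 + (h + 1) ^ 2 = 1 + (h * (h + 1)) * 2 := by ring
    rw [this, Int.add_mul_ediv_right _ _ (by norm_num)]
    simp

theorem maxSum_of_ge {h : ℕ} {c : ℤ} (hc : h ≤ |c|) : maxSum h c = h * |c| := by
  unfold maxSum
  split_ifs with h₁
  · rw [← sq_abs c, show |c| = h by omega]
    have : (h : ℤ) ^ 2 + h ^ 2 = (h * h) * 2 := by ring
    rw [this, Int.mul_ediv_cancel _ (by norm_num)]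
  · rfl

/-- The integers `t ≡ c (mod 2)` with `-h < t ≤ h` are the progression `h, h - 2, …, -h + 2`,
lowered by `1` if `h` and `c` have different parity. The formula for `h ≤ |c| + 1`, where every term
is `|c|`, extends to larger `h` in steps of two, each of which adds the terms `t` of largest absolute
value at both ends. -/
theorem sum_max_abs_eq_maxSum (h : ℕ) (c d : ℤ) (hd : d = (h + c) % 2) :
    ∑ i ∈ Finset.range h, max |c| |(h : ℤ) - 2 * i - d| = maxSum h c := by
  induction h using Nat.strong_induction_on with
  | _ h ih =>
    by_cases hc : (h : ℤ) ≤ |c| + 1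
    · have hterm : ∀ i ∈ Finset.range h, max |c| |(h : ℤ) - 2 * i - d| = |c| := by
        intro i hi
        have hi := Finset.mem_range.1 hi
        refine max_eq_left (abs_le.2 ?_)
        rcases abs_cases c with hc' | hc' <;> constructor <;> omega
      rw [Finset.sum_congr rfl hterm, Finset.sum_const, Finset.card_range, nsmul_eq_mul]
      rcases hc.lt_or_eq with hc | hc
      · exact (maxSum_of_ge (by omega)).symm
      · rw [maxSum_of_le (by omega), ← sq_abs c, hc]
        have : (|c| + 1) ^ 2 + |c| ^ 2 = 1 + ((|c| + 1) * |c|) * 2 := by ring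
        rw [this, Int.add_mul_ediv_right _ _ (by norm_num)]
        simp
    · obtain ⟨h, rfl⟩ := Nat.exists_eq_add_of_le' (show 2 ≤ h by have := abs_nonneg c; omega)
      push_cast at hc
      rw [Finset.sum_range_add_two_sub_two_mul (fun t ↦ max |c| |t - d|),
        ih h (by omega) (by push_cast at hd; omega), maxSum_of_le (by omega),
        maxSum_of_le (by push_cast; omega), max_eq_right, max_eq_right,
        abs_of_nonneg, abs_of_nonpos]
      · have : ((h + 2 : ℕ) : ℤ) ^ 2 + c ^ 2 = (h ^ 2 + c ^ 2) + (2 * h + 2) * 2 := by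
          push_cast; ring
        rw [this, Int.add_mul_ediv_right _ _ (by norm_num)]
        ring
      all_goals grind

namespace ZT

variable {n h : ℕ}

theorem sum_dist_row [NeZero h] (i i' : Fin (n + 1)) (k k' : Fin 2) (x : ZMod h) :
    ∑ s : ZMod h, ((ZT n h).dist (i, k, x) (i', k', s) : ℤ) =
      h * |(i' : ℤ) - (i : ℤ)| + maxSum h ((k' : ℤ) - (k : ℤ) + ((i' : ℤ) - (i : ℤ))) := by
  obtain ⟨j, rfl⟩ := ZMod.intCast_surjective x
  set a : ℤ := (i' : ℤ) - (i : ℤ) with ha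
  set c : ℤ := (k' : ℤ) - (k : ℤ) + a with hc
  -- the positions `b` with `-h < 2 * b - c ≤ h`, in the order of the progression above
  obtain ⟨d, hd⟩ : ∃ d, d = (h + c) % 2 := ⟨_, rfl⟩
  obtain ⟨e, he⟩ : ∃ e, 2 * e = h + c - d := ⟨(h + c) / 2, by omega⟩
  rw [ZMod.sum_eq_sum_range_add h (j + e - (h - 1)), ← Finset.sum_range_reflect,
    ← sum_max_abs_eq_maxSum h c d hd]
  have hterm : ∀ r ∈ Finset.range h, ((ZT n h).dist (i, k, (j : ZMod h))
      (i', k', ((j + e - (h - 1) + (h - 1 - r : ℕ) : ℤ) : ZMod h)) : ℤ) =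
      |a| + max |c| |(h : ℤ) - 2 * r - d| := by
    intro r hr
    have hr := Finset.mem_range.1 hr
    rw [show j + e - (h - 1) + (h - 1 - r : ℕ) = j + (e - r) by omega,
      dist_eq i i' k k' j (e - r) a c ha hc (by omega) (by omega)]
    congr 3
    omega
  rw [Finset.sum_congr rfl hterm, Finset.sum_add_distrib]
  simp

end ZT

/-! ### Automorphisms -/

theorem SimpleGraph.Reachable.dist_hom_le {V W : Type*} {G : SimpleGraph V} {G' : SimpleGraph W}
    {u v : V} (huv : G.Reachable u v) (f : G →g G') : G'.dist (f u) (f v) ≤ G.dist u v := by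
  obtain ⟨p, hp⟩ := huv.exists_walk_length_eq_dist
  rw [← hp, ← SimpleGraph.Walk.length_map f p]
  exact SimpleGraph.dist_le _

theorem SimpleGraph.Iso.dist_apply {V W : Type*} {G : SimpleGraph V} {G' : SimpleGraph W}
    (f : G ≃g G') (u v : V) : G'.dist (f u) (f v) = G.dist u v := by
  by_cases huv : G.Reachable u v
  · refine le_antisymm (huv.dist_hom_le f.toHom) ?_
    simpa using (f.reachable_iff.2 huv).dist_hom_le f.symm.toHom
  · rw [SimpleGraph.dist_eq_zero_of_not_reachable huv,
      SimpleGraph.dist_eq_zero_of_not_reachable (f.reachable_iff.not.2 huv)]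

namespace ZT

variable {n h : ℕ}

/-- The reflection that swaps the two ends of the tube. -/
def flip (n h : ℕ) : ZT n h ≃g ZT n h where
  toFun x := (x.1.rev, x.2.1.rev, -x.2.2)
  invFun x := (x.1.rev, x.2.1.rev, -x.2.2)
  left_inv x := by simp
  right_inv x := by simp
  map_rel_iff' := by
    rintro ⟨i, k, x⟩ ⟨i', k', x'⟩
    have h₃ : (i.rev : ℕ) = i'.rev + 1 ↔ (i' : ℕ) = i + 1 := by simp only [Fin.val_rev]; omega
    have h₄ : (i'.rev : ℕ) = i.rev + 1 ↔ (i : ℕ) = i' + 1 := by simp only [Fin.val_rev]; omega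
    have h₅ (k : Fin 2) : (k.rev = 0 ↔ k = 1) ∧ (k.rev = 1 ↔ k = 0) := by decide +revert
    simp only [ZT, ZTEdge, Equiv.coe_fn_mk, h₃, h₄, h₅, Fin.rev_inj, neg_inj]
    grind

/-- The rotation of the tube by `s` positions. -/
def rotation (n : ℕ) {h : ℕ} (s : ZMod h) : ZT n h ≃g ZT n h where
  toFun x := (x.1, x.2.1, x.2.2 + s)
  invFun x := (x.1, x.2.1, x.2.2 - s)
  left_inv x := by simp
  right_inv x := by simp
  map_rel_iff' := by
    rintro ⟨i, k, x⟩ ⟨i', k', x'⟩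
    simp [ZT, ZTEdge, add_right_comm _ s 1]

/-- The height of a vertex: vertices `(i, k, j)` with fixed `i` and `k` form a row, and the rows
are numbered `0, …, 2 * n + 1` from one end of the tube to the other. -/
def height (x : ZTVertex n h) : ℕ := 2 * x.1 + x.2.1

theorem height_le (x : ZTVertex n h) : height x ≤ 2 * n + 1 := by
  have := x.1.isLt
  have := x.2.1.isLt
  unfold height
  omega

theorem height_flip (x : ZTVertex n h) : height (flip n h x) = 2 * n + 1 - height x := by
  have := x.1.isLt
  have := x.2.1.isLt
  change 2 * (x.1.rev : ℕ) + (x.2.1.rev : ℕ) = 2 * n + 1 - (2 * (x.1 : ℕ) + x.2.1)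
  simp only [Fin.val_rev]
  omega

theorem height_eq_zero_iff (x : ZTVertex n h) : height x = 0 ↔ x.1 = 0 ∧ x.2.1 = 0 := by
  simp only [height, Fin.ext_iff, Fin.val_zero]
  omega

theorem abs_height_sub_le_dist (u v : ZTVertex n h) :
    |(height v : ℤ) - height u| ≤ (ZT n h).dist u v := by
  obtain ⟨i, k, x⟩ := u
  obtain ⟨i', k', x'⟩ := v
  obtain ⟨j, rfl⟩ := ZMod.intCast_surjective x
  obtain ⟨b, rfl⟩ := ZMod.intCast_surjective x'
  obtain ⟨b', -, hb'⟩ := exists_hexLength_le_dist (h := h) i i' k k' j (b - j)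
  rw [add_sub_cancel] at hb'
  refine le_trans ?_ hb'
  simp only [hexLength, height]
  push_cast
  grind

theorem exists_height_eq_zero_dist_le (u : ZTVertex n h) :
    ∃ v, height v = 0 ∧ (ZT n h).dist u v ≤ height u := by
  obtain ⟨i, k, x⟩ := u
  obtain ⟨j, rfl⟩ := ZMod.intCast_surjective x
  refine ⟨(0, 0, ((j + 0 : ℤ) : ZMod h)), by simp [height], ?_⟩
  have := dist_le_hexLength (h := h) i 0 k 0 j 0
  simp only [hexLength, height, Fin.val_zero] at *
  rw [abs_zero, abs_of_nonpos (by omega), abs_of_nonpos (by omega)] at this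
  omega

theorem eq_or_eq_of_adj_of_height_eq_zero {x y : ZTVertex n h} (hx : height x = 0)
    (hxy : (ZT n h).Adj x y) : y = (0, 1, x.2.2) ∨ y = (0, 1, x.2.2 + 1) := by
  obtain ⟨i, k, x⟩ := x
  obtain ⟨i', k', x'⟩ := y
  obtain ⟨rfl, rfl⟩ := (height_eq_zero_iff _).1 hx
  simp only [ZT, ZTEdge] at hxy
  grind

theorem eq_or_eq_of_adj_of_height_eq {x y : ZTVertex n h} (hx : height x = 2 * n + 1)
    (hxy : (ZT n h).Adj x y) : y = (Fin.last n, 0, x.2.2) ∨ y = (Fin.last n, 0, x.2.2 - 1) := by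
  have hflip := eq_or_eq_of_adj_of_height_eq_zero (by rw [height_flip, hx, Nat.sub_self])
    ((flip n h).map_adj_iff.2 hxy)
  rw [← (flip n h).injective.eq_iff, ← (flip n h).injective.eq_iff (b := (_, _, x.2.2 - 1))]
  simpa [flip, sub_eq_neg_add, add_comm] using hflip

/-- The rows at the two ends of the tube consist of the vertices of degree two. -/
theorem three_neighbors_iff (hh : 2 ≤ h) (x : ZTVertex n h) :
    (∃ y₁ y₂ y₃, (ZT n h).Adj x y₁ ∧ (ZT n h).Adj x y₂ ∧ (ZT n h).Adj x y₃ ∧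
      y₁ ≠ y₂ ∧ y₁ ≠ y₃ ∧ y₂ ≠ y₃) ↔ height x ≠ 0 ∧ height x ≠ 2 * n + 1 := by
  have : Fact (1 < h) := ⟨hh⟩
  constructor
  · rintro ⟨y₁, y₂, y₃, a₁, a₂, a₃, n₁, n₂, n₃⟩
    constructor <;> intro hx
    · have b₁ := eq_or_eq_of_adj_of_height_eq_zero hx a₁
      have b₂ := eq_or_eq_of_adj_of_height_eq_zero hx a₂
      have b₃ := eq_or_eq_of_adj_of_height_eq_zero hx a₃
      grind
    · have b₁ := eq_or_eq_of_adj_of_height_eq hx a₁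
      have b₂ := eq_or_eq_of_adj_of_height_eq hx a₂
      have b₃ := eq_or_eq_of_adj_of_height_eq hx a₃
      grind
  · obtain ⟨i, k, x⟩ := x
    rintro ⟨h₁, h₂⟩
    simp only [height] at h₁ h₂
    rcases (by omega : k = 0 ∨ k = 1) with rfl | rfl
    · simp only [Fin.val_zero] at h₁ h₂
      refine ⟨(i, 1, x), (i, 1, x + 1), (⟨i - 1, by omega⟩, 1, x),
        Or.inl ⟨rfl, rfl, Or.inl ⟨rfl, Or.inl rfl⟩⟩, Or.inl ⟨rfl, rfl, Or.inl ⟨rfl, Or.inr rfl⟩⟩,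
        Or.inl ⟨rfl, rfl, Or.inr ⟨by simp only; omega, rfl⟩⟩, ?_, ?_, ?_⟩
      · simp
      all_goals
        intro heq
        have := congrArg (fun v : ZTVertex n h ↦ (v.1 : ℕ)) heq
        simp only at this
        omega
    · simp only [Fin.val_one] at h₁ h₂
      refine ⟨(i, 0, x), (i, 0, x - 1), (⟨i + 1, by omega⟩, 0, x),
        Or.inr ⟨rfl, rfl, Or.inl ⟨rfl, Or.inl rfl⟩⟩,
        Or.inr ⟨rfl, rfl, Or.inl ⟨rfl, Or.inr (by simp)⟩⟩,
        Or.inr ⟨rfl, rfl, Or.inr ⟨rfl, rfl⟩⟩, ?_, ?_, ?_⟩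
      · simp [eq_sub_iff_add_eq]
      all_goals
        intro heq
        have := congrArg (fun v : ZTVertex n h ↦ (v.1 : ℕ)) heq
        simp only at this
        omega

theorem height_map_of_height_eq_zero (hh : 2 ≤ h) (α : ZT n h ≃g ZT n h) {x : ZTVertex n h}
    (hx : height x = 0) : height (α x) = 0 ∨ height (α x) = 2 * n + 1 := by
  have h₁ := (three_neighbors_iff hh (α x)).not
  have h₂ := (three_neighbors_iff hh x).not
  have h₃ : ¬ ∃ y₁ y₂ y₃, (ZT n h).Adj x y₁ ∧ (ZT n h).Adj x y₂ ∧ (ZT n h).Adj x y₃ ∧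
      y₁ ≠ y₂ ∧ y₁ ≠ y₃ ∧ y₂ ≠ y₃ := h₂.2 (by tauto)
  have h₄ : ¬ (height (α x) ≠ 0 ∧ height (α x) ≠ 2 * n + 1) := by
    refine h₁.1 fun ⟨y₁, y₂, y₃, a₁, a₂, a₃, n₁, n₂, n₃⟩ ↦
      h₃ ⟨α.symm y₁, α.symm y₂, α.symm y₃, ?_, ?_, ?_, by simpa, by simpa, by simpa⟩
    all_goals rw [← α.map_adj_iff]; simpa
  tauto

/-- An automorphism maps an end of the tube into one end: consecutive vertices of the end are at
distance two, while the two ends are at distance at least three. -/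
theorem height_map_eq_of_height_eq_zero (hn : 1 ≤ n) (hh : 2 ≤ h) (α : ZT n h ≃g ZT n h)
    {x y : ZTVertex n h} (hx : height x = 0) (hy : height y = 0) :
    height (α x) = height (α y) := by
  have : NeZero h := ⟨by omega⟩
  have key (r : ℕ) : height (α (0, 0, ((r : ℤ) : ZMod h))) =
      height (α (0, 0, ((0 : ℤ) : ZMod h))) := by
    induction r with
    | zero => rfl
    | succ r ih =>
      rw [← ih]
      have h₁ := dist_le_hexLength (n := n) (h := h) 0 0 0 0 r 1
      rw [← SimpleGraph.Iso.dist_apply α] at h₁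
      have h₂ := abs_height_sub_le_dist (α (0, 0, ((r : ℤ) : ZMod h)))
        (α (0, 0, ((r + 1 : ℤ) : ZMod h)))
      have h₃ := height_map_of_height_eq_zero hh α (x := (0, 0, ((r : ℤ) : ZMod h))) rfl
      have h₄ := height_map_of_height_eq_zero hh α (x := (0, 0, ((r + 1 : ℤ) : ZMod h))) rfl
      have h₅ : hexLength (((0 : Fin (n + 1)) : ℤ) - ((0 : Fin (n + 1)) : ℤ))
          (((0 : Fin 2) : ℤ) - ((0 : Fin 2) : ℤ)) 1 = 2 := by simp [hexLength]
      rw [h₅] at h₁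
      rw [Nat.cast_succ]
      obtain ⟨h₆, h₇⟩ := abs_le.1 (h₂.trans h₁)
      omega
  have key' (x : ZTVertex n h) (hx : height x = 0) :
      height (α x) = height (α (0, 0, ((0 : ℤ) : ZMod h))) := by
    obtain ⟨h₁, h₂⟩ := (height_eq_zero_iff x).1 hx
    rw [← key x.2.2.val]
    congr 2
    ext <;> simp [h₁, h₂]
  rw [key' x hx, key' y hy]

/-- The height is the distance to the row of height `0`, so it does not increase under an
automorphism that preserves this row. -/
theorem height_map_le (α : ZT n h ≃g ZT n h)
    (hα : ∀ x, height x = 0 → height (α x) = 0) (x : ZTVertex n h) : height (α x) ≤ height x := by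
  obtain ⟨v, hv, hle⟩ := exists_height_eq_zero_dist_le x
  rw [← SimpleGraph.Iso.dist_apply α] at hle
  have := abs_height_sub_le_dist (α x) (α v)
  rw [hα v hv] at this
  grind

theorem height_map_eq_of_exists (hn : 1 ≤ n) (hh : 2 ≤ h) (α : ZT n h ≃g ZT n h)
    {v : ZTVertex n h} (hv : height v = 0) (hαv : height (α v) = 0) (x : ZTVertex n h) :
    height (α x) = height x := by
  apply le_antisymm
  · exact height_map_le α (fun y hy ↦ by rw [height_map_eq_of_height_eq_zero hn hh α hy hv, hαv]) x
  · conv_lhs => rw [← α.symm_apply_apply x]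
    refine height_map_le α.symm (fun y hy ↦ ?_) (α x)
    rw [height_map_eq_of_height_eq_zero hn hh α.symm hy hαv, α.symm_apply_apply, hv]

/-- Every automorphism preserves all heights or reverses them. -/
theorem height_map (hn : 1 ≤ n) (hh : 2 ≤ h) (α : ZT n h ≃g ZT n h) :
    (∀ x, height (α x) = height x) ∨ ∀ x, height (α x) = 2 * n + 1 - height x := by
  have h₀ : height ((0, 0, 0) : ZTVertex n h) = 0 := rfl
  rcases height_map_of_height_eq_zero hh α h₀ with h₁ | h₁
  · exact Or.inl (height_map_eq_of_exists hn hh α h₀ h₁)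
  · right
    intro x
    have h₂ := height_map_eq_of_exists hn hh (α.trans (flip n h)) h₀
      (by rw [RelIso.trans_apply, height_flip, h₁, Nat.sub_self]) x
    rw [RelIso.trans_apply, height_flip] at h₂
    have := height_le (α x)
    omega

end ZT

/-! ### The index as a sum of row sums -/

namespace ZT

variable {n h : ℕ}

/-- The sum of `F` over the row of `v` and the row symmetric to it, which together form the orbit
of `v` under the automorphism group. -/
def orbitSum [NeZero h] (F : ZTVertex n h → ℚ) (v : ZTVertex n h) : ℚ :=
  ∑ s, F (v.1, v.2.1, s) + ∑ s, F (v.1.rev, v.2.1.rev, s)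

theorem orbitSum_map [NeZero h] (hn : 1 ≤ n) (hh : 2 ≤ h) (F : ZTVertex n h → ℚ)
    (α : ZT n h ≃g ZT n h) (v : ZTVertex n h) : orbitSum F (α v) = orbitSum F v := by
  have hrow : ∀ x y : ZTVertex n h, height x = height y → x.1 = y.1 ∧ x.2.1 = y.2.1 := by
    intro x y hxy
    simp only [height] at hxy
    omega
  rcases height_map hn hh α with hα | hα
  · obtain ⟨h₁, h₂⟩ := hrow _ _ (hα v)
    rw [orbitSum, h₁, h₂, orbitSum]
  · obtain ⟨h₁, h₂⟩ := hrow (α v) (flip n h v) (by rw [hα, height_flip])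
    have h₃ : (flip n h v).1 = v.1.rev := rfl
    have h₄ : (flip n h v).2.1 = v.2.1.rev := rfl
    rw [orbitSum, h₁, h₂, h₃, h₄, Fin.rev_rev, Fin.rev_rev, add_comm, orbitSum]

/-- Summing over the automorphisms amounts to averaging over the orbit: every automorphism may be
followed by any rotation, and by any rotation of the reflected tube. -/
theorem sum_automorphisms [NeZero h] [Fintype (ZT n h ≃g ZT n h)] (hn : 1 ≤ n) (hh : 2 ≤ h)
    (F : ZTVertex n h → ℚ) (u : ZTVertex n h) :
    2 * h * ∑ α : ZT n h ≃g ZT n h, F (α u) =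
      Fintype.card (ZT n h ≃g ZT n h) * orbitSum F u := by
  have hmul (β : ZT n h ≃g ZT n h) :
      ∑ α : ZT n h ≃g ZT n h, F (β (α u)) = ∑ α : ZT n h ≃g ZT n h, F (α u) :=
    Equiv.sum_comp (Equiv.mulLeft β) fun α ↦ F (α u)
  have h₁ : ∑ s : ZMod h, ∑ α : ZT n h ≃g ZT n h, (F (rotation n s (α u)) +
      F ((rotation n s * flip n h) (α u))) = 2 * h * ∑ α : ZT n h ≃g ZT n h, F (α u) := by
    simp only [Finset.sum_add_distrib, hmul]
    simp only [Finset.sum_const, Finset.card_univ, ZMod.card, nsmul_eq_mul]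
    ring
  have h₂ (v : ZTVertex n h) : ∑ s : ZMod h, (F (rotation n s v) +
      F ((rotation n s * flip n h) v)) = orbitSum F v := by
    rw [Finset.sum_add_distrib, orbitSum]
    congr 1
    · exact Equiv.sum_comp (Equiv.addLeft v.2.2) fun s ↦ F (v.1, v.2.1, s)
    · exact Equiv.sum_comp (Equiv.addLeft (-v.2.2)) fun s ↦ F (v.1.rev, v.2.1.rev, s)
  rw [← h₁, Finset.sum_comm]
  simp only [h₂, orbitSum_map hn hh]
  simp

theorem graovacPisanskiIndex_eq_sum_orbitSum [NeZero h] (hn : 1 ≤ n) (hh : 2 ≤ h) :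
    graovacPisanskiIndex (ZT n h) =
      ((n : ℚ) + 1) / 2 * ∑ u, orbitSum (fun v ↦ ((ZT n h).dist u v : ℚ)) u := by
  have : Finite (ZT n h ≃g ZT n h) := DFunLike.finite _
  have := Fintype.ofFinite (ZT n h ≃g ZT n h)
  have hsum (u : ZTVertex n h) : ∑ᶠ α : ZT n h ≃g ZT n h, ((ZT n h).dist u (α u) : ℚ) =
      (Nat.card (ZT n h ≃g ZT n h) : ℚ) / (2 * h) *
        orbitSum (fun v ↦ ((ZT n h).dist u v : ℚ)) u := by
    have := sum_automorphisms hn hh (fun v ↦ ((ZT n h).dist u v : ℚ)) u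
    have hh' : (h : ℚ) ≠ 0 := NeZero.ne _
    rw [finsum_eq_sum_of_fintype, Nat.card_eq_fintype_card]
    field_simp
    linarith
  have hcard : (Nat.card (ZT n h ≃g ZT n h) : ℚ) ≠ 0 := by
    exact_mod_cast Nat.card_pos.ne'
  have hh' : (h : ℚ) ≠ 0 := NeZero.ne _
  simp only [graovacPisanskiIndex, hsum, ← Finset.mul_sum, Fintype.card_prod, Fintype.card_fin,
    ZMod.card]
  push_cast
  field_simp

theorem orbitSum_dist [NeZero h] (u : ZTVertex n h) :
    orbitSum (fun v ↦ ((ZT n h).dist u v : ℚ)) u =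
      ((maxSum h 0 + h * |(n : ℤ) - 2 * u.1| +
        maxSum h (1 - 2 * u.2.1 + (n - 2 * u.1)) : ℤ) : ℚ) := by
  obtain ⟨i, k, x⟩ := u
  have h₁ := sum_dist_row i i k k x
  have h₂ := sum_dist_row i i.rev k k.rev x
  rw [show ((i.rev : ℕ) : ℤ) - i = n - 2 * i by rw [Fin.val_rev]; omega,
    show ((k.rev : ℕ) : ℤ) - k = 1 - 2 * k by rw [Fin.val_rev]; omega] at h₂
  simp only [sub_self, abs_zero, mul_zero, add_zero, zero_add] at h₁
  simp only [orbitSum]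
  rw [add_assoc, ← h₁, ← h₂]
  push_cast
  rfl

/-- The vertices of type `1` contribute as much as those of type `0`, since the reflection exchanges
them; hence the sums run over the layers `i` only. -/
theorem graovacPisanskiIndex_eq [NeZero h] (hn : 1 ≤ n) (hh : 2 ≤ h) :
    graovacPisanskiIndex (ZT n h) = ((n : ℚ) + 1) * h *
      (((n + 1) * maxSum h 0 + h * ∑ i ∈ Finset.range (n + 1), |(n : ℤ) - 2 * i| +
        ∑ i ∈ Finset.range (n + 1), maxSum h ((n + 1 : ℕ) - 2 * i) : ℤ) : ℚ) := by
  have hrefl : ∑ i ∈ Finset.range (n + 1), maxSum h (1 - 2 * (1 : ℤ) + (n - 2 * i)) =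
      ∑ i ∈ Finset.range (n + 1), maxSum h ((n + 1 : ℕ) - 2 * i) := by
    rw [← Finset.sum_range_reflect]
    refine Finset.sum_congr rfl fun i hi ↦ ?_
    have hi := Finset.mem_range.1 hi
    rw [← maxSum_neg]
    congr 1
    omega
  have hsum : ∑ u : ZTVertex n h, (maxSum h 0 + h * |(n : ℤ) - 2 * u.1| +
        maxSum h (1 - 2 * u.2.1 + (n - 2 * u.1))) =
      2 * h * ((n + 1) * maxSum h 0 + h * ∑ i ∈ Finset.range (n + 1), |(n : ℤ) - 2 * i| +
        ∑ i ∈ Finset.range (n + 1), maxSum h ((n + 1 : ℕ) - 2 * i)) := by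
    simp only [Fintype.sum_prod_type, Fin.sum_univ_two, Finset.sum_const, Finset.card_univ,
      ZMod.card, nsmul_eq_mul, Fin.val_zero, Fin.val_one, Nat.cast_zero, Nat.cast_one]
    rw [Fin.sum_univ_eq_sum_range (fun i : ℕ ↦
      (h : ℤ) * (maxSum h 0 + h * |(n : ℤ) - 2 * i| + maxSum h (1 - 2 * 0 + (n - 2 * i))) +
      (h : ℤ) * (maxSum h 0 + h * |(n : ℤ) - 2 * i| + maxSum h (1 - 2 * 1 + (n - 2 * i))))]
    simp only [Finset.sum_add_distrib, ← Finset.mul_sum, hrefl, Finset.sum_const,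
      Finset.card_range, nsmul_eq_mul]
    have hone : ∑ i ∈ Finset.range (n + 1), maxSum h (1 - 2 * (0 : ℤ) + (n - 2 * i)) =
        ∑ i ∈ Finset.range (n + 1), maxSum h ((n + 1 : ℕ) - 2 * i) :=
      Finset.sum_congr rfl fun i _ ↦ congrArg _ (by push_cast; ring)
    rw [hone]
    push_cast
    ring
  rw [graovacPisanskiIndex_eq_sum_orbitSum hn hh]
  simp only [orbitSum_dist]
  rw [← Int.cast_sum, hsum]
  push_cast
  ring

end ZT

/-! ### Evaluation of the sums -/

theorem sum_abs_sub_two_mul (n : ℕ) :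
    2 * ∑ i ∈ Finset.range (n + 1), |(n : ℤ) - 2 * i| = (n + 1) ^ 2 - (n + 1) % 2 := by
  induction n using Nat.twoStepInduction with
  | zero => simp
  | one => simp [Finset.sum_range_succ]
  | more m ih _ =>
    have := Finset.sum_range_add_two_sub_two_mul (fun t : ℤ ↦ |t - 1|) (m + 1)
    have h₁ : ∀ m : ℕ, ∑ i ∈ Finset.range (m + 1), |((m + 1 : ℕ) : ℤ) - 2 * i - 1| =
        ∑ i ∈ Finset.range (m + 1), |(m : ℤ) - 2 * i| := fun m ↦
      Finset.sum_congr rfl fun i _ ↦ congrArg _ (by push_cast; ring)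
    rw [h₁ m, show m + 1 + 2 = m + 2 + 1 from rfl, h₁ (m + 2)] at this
    rw [this, mul_add, mul_add, ih, abs_of_nonneg (by push_cast; omega),
      abs_of_nonpos (by push_cast; omega), show ((m + 2 : ℕ) + 1 : ℤ) % 2 = (m + 1) % 2 by omega]
    push_cast
    ring

/-- Short tubes: only the quadratic branch of `maxSum` occurs. -/
theorem sum_maxSum_of_le (h m : ℕ) (hm : m ≤ h + 1) :
    6 * ∑ i ∈ Finset.range m, maxSum h (m - 2 * i) =
      3 * m * ((h : ℤ) ^ 2 - (h + m) % 2) + m * ((m : ℤ) ^ 2 + 2) := by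
  have two_mul_maxSum {c : ℤ} (hc : |c| ≤ h + 1) :
      2 * maxSum h c = (h : ℤ) ^ 2 + c ^ 2 - (h + c) % 2 := by
    have h₁ : ((h : ℤ) ^ 2 + c ^ 2) % 2 = (h + c) % 2 := by
      rcases Int.even_or_odd' (h : ℤ) with ⟨a, ha | ha⟩ <;>
        rcases Int.even_or_odd' c with ⟨b, hb | hb⟩ <;> rw [ha, hb] <;> ring_nf <;> omega
    rw [maxSum_of_le hc]
    omega
  induction m using Nat.twoStepInduction with
  | zero => simp
  | one =>
    have := two_mul_maxSum (c := 1) (by simp)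
    simp
    linarith
  | more m ih _ =>
    have h₁ := two_mul_maxSum (c := m + 2) (by rw [abs_of_nonneg] <;> omega)
    have h₂ := two_mul_maxSum (c := m) (by rw [abs_of_nonneg] <;> omega)
    rw [Finset.sum_range_add_two_sub_two_mul, mul_add, mul_add, ih (by omega), maxSum_neg]
    rw [show ((h : ℤ) + (m + 2)) % 2 = (h + m) % 2 by omega] at h₁
    rw [show ((h : ℤ) + (m + 2 : ℕ)) % 2 = (h + m) % 2 by omega]
    push_cast
    linarith

/-- Long tubes: the sums for the lengths `h` and `h + 1` are extended by the linear branch of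
`maxSum`. -/
theorem sum_maxSum_of_ge (h m : ℕ) (hm : h ≤ m) :
    6 * ∑ i ∈ Finset.range m, maxSum h (m - 2 * i) =
      3 * h * (m : ℤ) ^ 2 + (h : ℤ) ^ 3 + 2 * h - 3 * h * ((h + m) % 2) := by
  induction m using Nat.strong_induction_on with
  | _ m ih =>
    rcases (by omega : m = h ∨ m = h + 1 ∨ h + 2 ≤ m) with rfl | rfl | hm'
    · rw [sum_maxSum_of_le _ _ (by omega), show ((m : ℤ) + m) % 2 = 0 by omega]
      ring
    · rw [sum_maxSum_of_le _ _ le_rfl, show ((h : ℤ) + (h + 1 : ℕ)) % 2 = 1 by omega]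
      push_cast
      ring
    · obtain ⟨m, rfl⟩ := Nat.exists_eq_add_of_le' (show 2 ≤ m by omega)
      rw [Finset.sum_range_add_two_sub_two_mul, mul_add, mul_add, ih m (by omega) (by omega),
        maxSum_neg, maxSum_of_ge (c := m + 2) (by rw [abs_of_nonneg] <;> omega),
        maxSum_of_ge (c := m) (by rw [abs_of_nonneg] <;> omega), abs_of_nonneg (by omega),
        abs_of_nonneg (by omega), show ((h : ℤ) + (m + 2 : ℕ)) % 2 = (h + m) % 2 by omega]
      push_cast
      ring

namespace ZT

variable {n h : ℕ}

theorem two_mul_maxSum_zero (h : ℕ) : 2 * maxSum h 0 = (h : ℤ) ^ 2 - h % 2 := by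
  have h₁ : ((h : ℤ) ^ 2) % 2 = h % 2 := by
    rcases Int.even_or_odd' (h : ℤ) with ⟨a, ha | ha⟩ <;> rw [ha] <;> ring_nf <;> omega
  rw [maxSum_of_le (by rw [abs_zero]; omega)]
  simp only [ne_eq, OfNat.ofNat_ne_zero, not_false_eq_true, zero_pow, add_zero]
  omega

/-- The index of a short tube; `p`, `q` and `r` are the parities of `h`, `n + 1` and their sum. -/
theorem graovacPisanskiIndex_eq_of_le [NeZero h] (hn : 1 ≤ n) (hh : 2 ≤ h) (hnh : n ≤ h)
    (p q r : ℤ) (hp : (h : ℤ) % 2 = p) (hq : (n + 1 : ℤ) % 2 = q)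
    (hr : (h + (n + 1 : ℕ) : ℤ) % 2 = r) :
    graovacPisanskiIndex (ZT n h) = ((n : ℚ) + 1) * h / 6 *
      (3 * (n + 1) * ((h : ℚ) ^ 2 - p) + 3 * h * ((n + 1) ^ 2 - q) +
        3 * (n + 1) * ((h : ℚ) ^ 2 - r) + (n + 1) * (((n : ℚ) + 1) ^ 2 + 2)) := by
  have h₁ := two_mul_maxSum_zero h
  have h₂ := sum_abs_sub_two_mul n
  have h₃ := sum_maxSum_of_le h (n + 1) (by omega)
  rw [hp] at h₁
  rw [hq] at h₂
  rw [hr] at h₃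
  apply_fun ((↑) : ℤ → ℚ) at h₁ h₂ h₃
  rw [graovacPisanskiIndex_eq hn hh]
  push_cast at *
  linear_combination ((n : ℚ) + 1) * h / 2 * ((n + 1) * h₁ + h * h₂) +
    ((n : ℚ) + 1) * h / 6 * h₃

/-- The index of a long tube; `p`, `q` and `r` are the parities of `h`, `n + 1` and their sum. -/
theorem graovacPisanskiIndex_eq_of_ge [NeZero h] (hn : 1 ≤ n) (hh : 2 ≤ h) (hnh : h ≤ n)
    (p q r : ℤ) (hp : (h : ℤ) % 2 = p) (hq : (n + 1 : ℤ) % 2 = q)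
    (hr : (h + (n + 1 : ℕ) : ℤ) % 2 = r) :
    graovacPisanskiIndex (ZT n h) = ((n : ℚ) + 1) * h / 6 *
      (3 * (n + 1) * ((h : ℚ) ^ 2 - p) + 3 * h * ((n + 1) ^ 2 - q) +
        3 * h * ((n : ℚ) + 1) ^ 2 + (h : ℚ) ^ 3 + 2 * h - 3 * h * r) := by
  have h₁ := two_mul_maxSum_zero h
  have h₂ := sum_abs_sub_two_mul n
  have h₃ := sum_maxSum_of_ge h (n + 1) (by omega)
  rw [hp] at h₁
  rw [hq] at h₂
  rw [hr] at h₃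
  apply_fun ((↑) : ℤ → ℚ) at h₁ h₂ h₃
  rw [graovacPisanskiIndex_eq hn hh]
  push_cast at *
  linear_combination ((n : ℚ) + 1) * h / 2 * ((n + 1) * h₁ + h * h₂) +
    ((n : ℚ) + 1) * h / 6 * h₃

end ZT

theorem mainTheorem4 (n h : ℕ) [NeZero h] (hn : 1 ≤ n) (hh : 2 ≤ h) :
    -- `h` odd, `n` odd
    (Odd h → Odd n →
      (n + 2 < h →
        graovacPisanskiIndex (ZT n h) =
          (h : ℚ) / 6 * ((n : ℚ) + 1) ^ 2 *
            (6 * (h : ℚ) ^ 2 + 3 * h * n + 3 * h + (n : ℚ) ^ 2 + 2 * n - 3)) ∧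
      (n + 2 = h → 3 ≤ n →
        graovacPisanskiIndex (ZT n h) =
          (h : ℚ) / 6 * ((n : ℚ) + 1) *
            (6 * (h : ℚ) ^ 2 * n + 3 * (h : ℚ) ^ 2 + 3 * h * (n : ℚ) ^ 2 + 12 * h * n + 9 * h
              + (n : ℚ) ^ 3 - 7 * n - 3)) ∧
      (h ≤ n → 5 ≤ h →
        graovacPisanskiIndex (ZT n h) =
          (h : ℚ) / 6 * ((n : ℚ) + 1) *
            ((h : ℚ) ^ 3 + 3 * (h : ℚ) ^ 2 * n + 3 * (h : ℚ) ^ 2 + 6 * h * (n : ℚ) ^ 2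
              + 12 * h * n + 5 * h - 3 * n - 3))) ∧
    -- `h` even, `n` odd
    (Even h → Odd n →
      (n + 2 < h →
        graovacPisanskiIndex (ZT n h) =
          (h : ℚ) / 6 * ((n : ℚ) + 1) ^ 2 *
            (6 * (h : ℚ) ^ 2 + 3 * h * n + 3 * h + (n : ℚ) ^ 2 + 2 * n + 3)) ∧
      (n + 1 = h → 3 ≤ n →
        graovacPisanskiIndex (ZT n h) =
          (h : ℚ) / 6 * ((n : ℚ) + 1) *
            (6 * (h : ℚ) ^ 2 * n + 3 * (h : ℚ) ^ 2 + 3 * h * (n : ℚ) ^ 2 + 12 * h * n + 9 * h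
              + (n : ℚ) ^ 3 - n)) ∧
      (h ≤ n → 4 ≤ h →
        graovacPisanskiIndex (ZT n h) =
          (h : ℚ) ^ 2 / 6 * ((n : ℚ) + 1) *
            ((h : ℚ) ^ 2 + 3 * h * n + 3 * h + 6 * (n : ℚ) ^ 2 + 12 * n + 8))) ∧
    -- `h` odd, `n` even
    (Odd h → Even n →
      (n + 2 < h →
        graovacPisanskiIndex (ZT n h) =
          (h : ℚ) / 6 * ((n : ℚ) + 1) *
            (6 * (h : ℚ) ^ 2 * n + 6 * (h : ℚ) ^ 2 + 3 * h * (n : ℚ) ^ 2 + 6 * h * n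
              + (n : ℚ) ^ 3 + 3 * (n : ℚ) ^ 2 + 2 * n)) ∧
      (n + 1 = h → 4 ≤ n →
        graovacPisanskiIndex (ZT n h) =
          (h : ℚ) / 6 * ((n : ℚ) + 1) *
            (6 * (h : ℚ) ^ 2 * n + 3 * (h : ℚ) ^ 2 + 3 * h * (n : ℚ) ^ 2 + 12 * h * n + 6 * h
              + (n : ℚ) ^ 3 - 4 * n - 3)) ∧
      (h ≤ n → 5 ≤ h →
        graovacPisanskiIndex (ZT n h) =
          (h : ℚ) / 6 * ((n : ℚ) + 1) *
            ((h : ℚ) ^ 3 + 3 * (h : ℚ) ^ 2 * n + 3 * (h : ℚ) ^ 2 + 6 * h * (n : ℚ) ^ 2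
              + 12 * h * n + 5 * h - 3 * n - 3))) ∧
    -- `h` even, `n` even
    (Even h → Even n →
      (n + 2 < h →
        graovacPisanskiIndex (ZT n h) =
          (h : ℚ) / 6 * ((n : ℚ) + 1) *
            (6 * (h : ℚ) ^ 2 * n + 6 * (h : ℚ) ^ 2 + 3 * h * (n : ℚ) ^ 2 + 6 * h * n
              + (n : ℚ) ^ 3 + 3 * (n : ℚ) ^ 2 + 2 * n)) ∧
      (n + 2 = h → 4 ≤ n →
        graovacPisanskiIndex (ZT n h) =
          (h : ℚ) / 6 * ((n : ℚ) + 1) *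
            (6 * (h : ℚ) ^ 2 * n + 3 * (h : ℚ) ^ 2 + 3 * h * (n : ℚ) ^ 2 + 12 * h * n + 6 * h
              + (n : ℚ) ^ 3 - 4 * n)) ∧
      (h ≤ n → 6 ≤ h →
        graovacPisanskiIndex (ZT n h) =
          (h : ℚ) ^ 2 / 6 * ((n : ℚ) + 1) *
            ((h : ℚ) ^ 2 + 3 * h * n + 3 * h + 6 * (n : ℚ) ^ 2 + 12 * n + 2))) := by
  refine ⟨fun ⟨a, ha⟩ ⟨b, hb⟩ ↦ ?_, fun ⟨a, ha⟩ ⟨b, hb⟩ ↦ ?_,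
    fun ⟨a, ha⟩ ⟨b, hb⟩ ↦ ?_, fun ⟨a, ha⟩ ⟨b, hb⟩ ↦ ?_⟩
  · refine ⟨fun hlt ↦ ?_, fun heq _ ↦ ?_, fun hle _ ↦ ?_⟩
    · rw [ZT.graovacPisanskiIndex_eq_of_le hn hh (by omega) 1 0 1 (by omega) (by omega) (by omega)]
      push_cast
      ring
    · rw [ZT.graovacPisanskiIndex_eq_of_le hn hh (by omega) 1 0 1 (by omega) (by omega) (by omega),
        ← heq]
      push_cast
      ring
    · rw [ZT.graovacPisanskiIndex_eq_of_ge hn hh hle 1 0 1 (by omega) (by omega) (by omega)]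
      push_cast
      ring
  · refine ⟨fun hlt ↦ ?_, fun heq _ ↦ ?_, fun hle _ ↦ ?_⟩
    · rw [ZT.graovacPisanskiIndex_eq_of_le hn hh (by omega) 0 0 0 (by omega) (by omega) (by omega)]
      push_cast
      ring
    · rw [ZT.graovacPisanskiIndex_eq_of_le hn hh (by omega) 0 0 0 (by omega) (by omega) (by omega),
        ← heq]
      push_cast
      ring
    · rw [ZT.graovacPisanskiIndex_eq_of_ge hn hh hle 0 0 0 (by omega) (by omega) (by omega)]
      push_cast
      ring
  · refine ⟨fun hlt ↦ ?_, fun heq _ ↦ ?_, fun hle _ ↦ ?_⟩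
    · rw [ZT.graovacPisanskiIndex_eq_of_le hn hh (by omega) 1 1 0 (by omega) (by omega) (by omega)]
      push_cast
      ring
    · rw [ZT.graovacPisanskiIndex_eq_of_le hn hh (by omega) 1 1 0 (by omega) (by omega) (by omega),
        ← heq]
      push_cast
      ring
    · rw [ZT.graovacPisanskiIndex_eq_of_ge hn hh hle 1 1 0 (by omega) (by omega) (by omega)]
      push_cast
      ring
  · refine ⟨fun hlt ↦ ?_, fun heq _ ↦ ?_, fun hle _ ↦ ?_⟩
    · rw [ZT.graovacPisanskiIndex_eq_of_le hn hh (by omega) 0 1 1 (by omega) (by omega) (by omega)]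
      push_cast
      ring
    · rw [ZT.graovacPisanskiIndex_eq_of_le hn hh (by omega) 0 1 1 (by omega) (by omega) (by omega),
        ← heq]
      push_cast
      ring
    · rw [ZT.graovacPisanskiIndex_eq_of_ge hn hh hle 0 1 1 (by omega) (by omega) (by omega)]
      push_cast
      ring
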